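/- **Setting.** Let $M$ be a compact smooth manifold of dimension $m$. A *transversely holomorphic foliation* $\mathcal F$ of complex codimension $r$ on $M$ is given by an open cover $\{U_i\}$ of $M$, submersions $\pi_i:U_i\to\mathbb C^r$ with connected fibres, and biholomorphic transition maps $\gamma_{ij}:\pi_j(U_i\cap U_j)\to\pi_i(U_i\cap U_j)$ with $\pi_i=\gamma_{ij}\circ\pi_j$; it is *transversely Hermitian* if it is equipped with smooth Hermitian metrics on the sets $\pi_i(U_i)$ that are invariant under the $\gamma_{ij}$. Write $\pi_i=(z^1,\dots,z^r)$, $T\mathcal F=\ker d\pi_i$ and $\mathcal N^*\mathcal F^{1,0}=\langle dz^1,\dots,dz^r\rangle_{\mathbb C}\subset T^*M\otimes\mathbb C$. A smooth complex-valued form $\alpha$ on $M$ is *basic* if $\iota_X\alpha=\iota_Xd\alpha=0$ for every $X$ tangent to the leaves, and a basic form has *type $(p,q)$* if at every point it is a complex linear combination of forms $\theta_1\wedge\dots\wedge\theta_p\wedge\bar\eta_1\wedge\dots\wedge\bar\eta_q$ with $\theta_i,\eta_j\in\mathcal N^*\mathcal F^{1,0}$. For $1\le p\le r$, a basic $(p,p)$-form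 $\omega$ is *transverse positive* if at every point $x\in M$ and for all linearly independent $\tau_1,\dots,\tau_{r-p}\in\mathcal N^*\mathcal F^{1,0}_x$ the $(r,r)$-form $$\omega\wedge\sqrt{-1}\,\tau_1\wedge\bar\tau_1\wedge\dots\wedge\sqrt{-1}\,\tau_{r-p}\wedge\bar\tau_{r-p}$$ is strictly positive at $x$, that is, a positive multiple of $\sqrt{-1}\,\theta_1\wedge\bar\theta_1\wedge\dots\wedge\sqrt{-1}\,\theta_r\wedge\bar\theta_r$ for a basis $\theta_1,\dots,\theta_r$ of $\mathcal N^*\mathcal F^{1,0}_x$. Let $U$ be an open neighbourhood of $0$ in $\mathbb R^d$. A family $\{\mathcal F_t\}_{t\in U}$ of transversely Hermitian foliations of complex codimension $r$ on $M$ is *smooth* if the subbundles $\mathcal N^*\mathcal F_t^{1,0}$ of $T^*M\otimes\mathbb C$ have local frames that are smooth in $(t,x)$ and the transverse Hermitian metrics, pulled back to $M$, are smooth in $(t,x)$. It has *fixed differentiable type* if there are diffeomorphisms $h_t$ of $M$ ($t\in U$), smooth in $(t,x)$, with $h_t^*\mathcal F_t=\mathcal F_0$ as foliations, that is, $(dh_t)_x^{-1}(T_{h_t(x)}\mathcal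 F_t)=T_x\mathcal F_0$ for all $x\in M$. **Proposition (deformation openness of transverse positivity).** Let $\{\mathcal F_t\}_{t\in U}$ be a smooth family of transversely Hermitian foliations of complex codimension $r$, with fixed differentiable type, on the compact manifold $M$, and let $1\le p\le r$. For $t\in U$ let $\Omega_t$ be a real basic form of type $(p,p)$ for $\mathcal F_t$, depending smoothly on $t$ (its coefficients are smooth in $(t,x)$). If $\Omega_0$ is transverse positive for $\mathcal F_0$, then there is $\varepsilon>0$ such that $\Omega_t$ is transverse positive for $\mathcal F_t$ for every $t\in U$ with $|t|<\varepsilon$. -/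

import Mathlib

open scoped Manifold ContDiff Topology ComplexConjugate

noncomputable section

namespace TransverseFoliation

/-! ### Linear algebra of complex-valued alternating forms on a real vector space -/

section LinearAlgebra

variable {V : Type*} [AddCommGroup V] [Module ℝ V] [TopologicalSpace V]

/-- The complex conjugate of a complex-valued covector. -/
def conjCovector (θ : V →L[ℝ] ℂ) : V →L[ℝ] ℂ :=
  (Complex.conjCLE : ℂ →L[ℝ] ℂ).comp θ

theorem of_update_row {n : ℕ} (θ : Fin n → (V →L[ℝ] ℂ)) [DecidableEq (Fin n)] (v : Fin n → V) (i : Fin n) (z : V) :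
    (Matrix.of fun a j => θ j (Function.update v i z a)) =
        (Matrix.of fun a j => θ j (v a)).updateRow i fun j => θ j z := by
  ext a j
  by_cases ha : a = i
  · subst ha; simp
  · simp [ha]

/-- The wedge product `θ₁ ∧ ⋯ ∧ θₙ` of covectors, `(v₁, …, vₙ) ↦ det (θⱼ (vᵢ))`. -/
def wedgeCovectors {n : ℕ} (θ : Fin n → (V →L[ℝ] ℂ)) : V [⋀^Fin n]→ₗ[ℝ] ℂ where
  toFun v := Matrix.det (Matrix.of fun i j => θ j (v i))
  map_update_add' {hd} v i x y := by
    have e : hd = instDecidableEqFin n := Subsingleton.elim _ _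
    subst e
    rw [of_update_row, of_update_row, of_update_row, ← Matrix.det_updateRow_add]
    simp [Pi.add_def]
  map_update_smul' {hd} v i c x := by
    have e : hd = instDecidableEqFin n := Subsingleton.elim _ _
    subst e
    rw [of_update_row, of_update_row, Complex.real_smul, ← Matrix.det_updateRow_smul]
    simp [Pi.smul_def]
  map_eq_zero_of_eq' v i j hij hne :=
    Matrix.det_zero_of_row_eq hne (by ext k; simp [hij])

/-- The wedge product of complex-valued alternating forms. -/
def wedge {k l : ℕ} (α : V [⋀^Fin k]→ₗ[ℝ] ℂ) (β : V [⋀^Fin l]→ₗ[ℝ] ℂ) :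
    V [⋀^Fin (k + l)]→ₗ[ℝ] ℂ :=
  ((LinearMap.mul' ℝ ℂ).compAlternatingMap (α.domCoprod β)).domDomCongr finSumFinEquiv

/-- The form `√-1 τ₁ ∧ τ̄₁ ∧ ⋯ ∧ √-1 τ_q ∧ τ̄_q`; the index `finProdFinEquiv (i, j) = j + 2 i`
lists the covectors in the order `τ₁, τ̄₁, τ₂, τ̄₂, …`. -/
def elementaryForm {q : ℕ} (τ : Fin q → (V →L[ℝ] ℂ)) : V [⋀^Fin (q * 2)]→ₗ[ℝ] ℂ :=
  Complex.I ^ q • wedgeCovectors fun a : Fin (q * 2) =>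
    ![τ (finProdFinEquiv.symm a).1, conjCovector (τ (finProdFinEquiv.symm a).1)]
      (finProdFinEquiv.symm a).2

/-- Given the space `W` of covectors of type `(1,0)`, the space of forms of type `(p,q)`: the
complex span of the forms `θ₁ ∧ ⋯ ∧ θ_p ∧ η̄₁ ∧ ⋯ ∧ η̄_q` with all `θᵢ`, `ηⱼ` in `W`. -/
def formsOfType (W : Submodule ℂ (V →L[ℝ] ℂ)) (p q : ℕ) :
    Submodule ℂ (V [⋀^Fin (p + q)]→ₗ[ℝ] ℂ) :=
  Submodule.span ℂ {α | ∃ (θ : Fin p → (V →L[ℝ] ℂ)) (η : Fin q → (V →L[ℝ] ℂ)),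
    (∀ i, θ i ∈ W) ∧ (∀ j, η j ∈ W) ∧
      α = wedgeCovectors (Fin.append θ fun j => conjCovector (η j))}

/-- Given the `r`-dimensional space `W` of covectors of type `(1,0)`, strict positivity of a form
of top type `(r,r)`: it is a positive multiple of `√-1 θ₁ ∧ θ̄₁ ∧ ⋯ ∧ √-1 θ_r ∧ θ̄_r` for a basis
`θ₁, …, θ_r` of `W`. The degree `n` is `2r`. -/
def IsStrictlyPositiveVolume (W : Submodule ℂ (V →L[ℝ] ℂ)) (r : ℕ) {n : ℕ} (hn : r * 2 = n)
    (η : V [⋀^Fin n]→ₗ[ℝ] ℂ) : Prop :=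
  ∃ θ : Fin r → (V →L[ℝ] ℂ), LinearIndependent ℂ θ ∧ Submodule.span ℂ (Set.range θ) = W ∧
    ∃ c : ℝ, 0 < c ∧ η = (c : ℂ) • (elementaryForm θ).domDomCongr (finCongr hn)

/-- Given the `r`-dimensional space `W` of covectors of type `(1,0)`, a `(p,p)`-form `α`
(with `p ≤ r`) is transverse if `α ∧ √-1 τ₁ ∧ τ̄₁ ∧ ⋯ ∧ √-1 τ_{r-p} ∧ τ̄_{r-p}` is strictly
positive for all linearly independent `τ₁, …, τ_{r-p}` in `W`. -/
def IsTransverseForm (W : Submodule ℂ (V →L[ℝ] ℂ)) (r p : ℕ) (hp : p ≤ r)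
    (α : V [⋀^Fin (p + p)]→ₗ[ℝ] ℂ) : Prop :=
  ∀ τ : Fin (r - p) → (V →L[ℝ] ℂ), (∀ j, τ j ∈ W) → LinearIndependent ℂ τ →
    IsStrictlyPositiveVolume W r (by omega : r * 2 = p + p + (r - p) * 2)
      (wedge α (elementaryForm τ))

end LinearAlgebra

/-! ### Complex-valued differential forms on a smooth manifold of dimension `m` -/

section Manifold

variable {m : ℕ} {M : Type*} [TopologicalSpace M] [ChartedSpace (EuclideanSpace ℝ (Fin m)) M]

/-- The tangent space of `M` at `x`. -/
abbrev Tangent (m : ℕ) {M : Type*} [TopologicalSpace M]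
    [ChartedSpace (EuclideanSpace ℝ (Fin m)) M] (x : M) : Type :=
  TangentSpace (𝓡 m) x

/-- (Not necessarily continuous) complex-valued differential forms of degree `k` on `M`. -/
abbrev Form (m : ℕ) (M : Type*) [TopologicalSpace M]
    [ChartedSpace (EuclideanSpace ℝ (Fin m)) M] (k : ℕ) : Type _ :=
  ∀ x : M, (Tangent m x) [⋀^Fin k]→L[ℝ] ℂ

/-- The target of the chart around `x₀`, an open subset of `ℝᵐ`. -/
def chartTarget (x₀ : M) : Set (EuclideanSpace ℝ (Fin m)) :=
  (extChartAt (𝓡 m) x₀).target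

/-- The inverse `φ⁻¹` of the chart `φ` around `x₀`. -/
def chartInv (x₀ : M) : EuclideanSpace ℝ (Fin m) → M :=
  (extChartAt (𝓡 m) x₀).symm

/-- The differential of `φ⁻¹` at the point `y`, where `φ` is the chart around `x₀`. -/
def chartInvDeriv (x₀ : M) (y : EuclideanSpace ℝ (Fin m)) :
    EuclideanSpace ℝ (Fin m) →L[ℝ] Tangent m (chartInv x₀ y) :=
  mfderiv 𝓘(ℝ, EuclideanSpace ℝ (Fin m)) (𝓡 m) (chartInv x₀) y

/-- The expression `(φ⁻¹)^* α` of a form `α` in the chart `φ` around `x₀`. -/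
def Form.inChart {k : ℕ} (α : Form m M k) (x₀ : M) (y : EuclideanSpace ℝ (Fin m)) :
    (EuclideanSpace ℝ (Fin m)) [⋀^Fin k]→L[ℝ] ℂ :=
  (α (chartInv x₀ y)).compContinuousLinearMap (chartInvDeriv x₀ y)

/-- Smoothness of a form: its expressions in charts are smooth. -/
def Form.IsSmooth {k : ℕ} (α : Form m M k) : Prop :=
  ∀ x₀ : M, ContDiffOn ℝ ∞ (α.inChart x₀) (chartTarget x₀)

/-- The exterior derivative, computed at `x` in the chart around `x`. -/
def Form.d {k : ℕ} (α : Form m M k) : Form m M (k + 1) := fun x =>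
  (extDeriv (α.inChart x) (extChartAt (𝓡 m) x x)).compContinuousLinearMap
    (mfderiv (𝓡 m) 𝓘(ℝ, EuclideanSpace ℝ (Fin m)) (extChartAt (𝓡 m) x) x)

/-- A form is real if it takes real values. -/
def Form.IsReal {k : ℕ} (α : Form m M k) : Prop :=
  ∀ x v, conj (α x v) = α x v

/-- A family `α t`, `t ∈ U`, of forms depends smoothly on `t`: its expressions in charts are
jointly smooth in the parameter and the point. -/
def Form.SmoothFamilyOn {P : Type*} [NormedAddCommGroup P] [NormedSpace ℝ P] {k : ℕ} (U : Set P)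
    (α : P → Form m M k) : Prop :=
  ∀ x₀ : M, ContDiffOn ℝ ∞
    (fun q : P × EuclideanSpace ℝ (Fin m) => (α q.1).inChart x₀ q.2) (U ×ˢ chartTarget x₀)

end Manifold

/-! ### Transversely holomorphic and transversely Hermitian foliations -/

/-- A transversely holomorphic foliation of complex codimension `r` on `M`, given by a cocycle:
an open cover `(U i)`, submersions `π i : U i → ℂʳ` with connected fibres, and holomorphic
transition maps `γ i j : π j (U i ∩ U j) → π i (U i ∩ U j)` with `π i = γ i j ∘ π j`
on `U i ∩ U j`. (These identities make `γ j i` inverse to `γ i j`, so the transition maps are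
biholomorphic.) -/
structure TransverselyHolomorphicFoliation (m r : ℕ) (M : Type*) [TopologicalSpace M]
    [ChartedSpace (EuclideanSpace ℝ (Fin m)) M] where
  /-- the index set of the cocycle -/
  Index : Type*
  /-- the members of the open cover -/
  U : Index → Set M
  /-- the local submersions -/
  π : Index → M → (Fin r → ℂ)
  /-- the transition maps -/
  γ : Index → Index → (Fin r → ℂ) → (Fin r → ℂ)
  isOpen_U : ∀ i, IsOpen (U i)
  cover : ∀ x, ∃ i, x ∈ U i
  smooth_π : ∀ i, ContMDiffOn (𝓡 m) 𝓘(ℝ, Fin r → ℂ) ∞ (π i) (U i)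
  submersion_π : ∀ i, ∀ x ∈ U i,
    Function.Surjective (mfderiv (𝓡 m) 𝓘(ℝ, Fin r → ℂ) (π i) x)
  connected_fibres : ∀ i z, IsPreconnected (U i ∩ π i ⁻¹' {z})
  holomorphic_γ : ∀ i j, DifferentiableOn ℂ (γ i j) (π j '' (U i ∩ U j))
  cocycle : ∀ i j, ∀ x ∈ U i ∩ U j, π i x = γ i j (π j x)

namespace TransverselyHolomorphicFoliation

variable {m r : ℕ} {M : Type*} [TopologicalSpace M] [ChartedSpace (EuclideanSpace ℝ (Fin m)) M]

/-- The differential of the local submersion `π i` at `x`. -/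
def dπ (F : TransverselyHolomorphicFoliation m r M) (i : F.Index) (x : M) :
    Tangent m x →L[ℝ] (Fin r → ℂ) :=
  mfderiv (𝓡 m) 𝓘(ℝ, Fin r → ℂ) (F.π i) x

/-- The covector `dzᵏ` at `x`, where `zᵏ` is the `k`-th component of `π i`. -/
def dz (F : TransverselyHolomorphicFoliation m r M) (i : F.Index) (k : Fin r) (x : M) :
    Tangent m x →L[ℝ] ℂ :=
  (ContinuousLinearMap.proj (R := ℝ) (φ := fun _ : Fin r => ℂ) k).comp (F.dπ i x)

/-- The tangent space `T_x 𝓕` of the leaf through `x`: the kernel of `dπ i` at `x`, for any (hence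
every) `i` with `x ∈ U i`. -/
def leafTangent (F : TransverselyHolomorphicFoliation m r M) (x : M) :
    Submodule ℝ (Tangent m x) :=
  ⨅ (i : F.Index) (_ : x ∈ F.U i), LinearMap.ker (F.dπ i x : Tangent m x →ₗ[ℝ] (Fin r → ℂ))

/-- The space `N^*𝓕^{1,0}_x = ⟨dz¹, …, dzʳ⟩_ℂ`, for any (hence every) `i` with `x ∈ U i`. -/
def conormal10 (F : TransverselyHolomorphicFoliation m r M) (x : M) :
    Submodule ℂ (Tangent m x →L[ℝ] ℂ) :=
  ⨆ (i : F.Index) (_ : x ∈ F.U i), Submodule.span ℂ (Set.range fun k => F.dz i k x)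

/-- Basic forms: smooth forms `α` with `ι_X α = ι_X dα = 0` for all `X` tangent to the leaves. -/
structure IsBasic (F : TransverselyHolomorphicFoliation m r M) {k : ℕ} (α : Form m M k) :
    Prop where
  smooth : α.IsSmooth
  contract : ∀ x (v : Fin k → Tangent m x), (∃ i, v i ∈ F.leafTangent x) → α x v = 0
  contract_d : ∀ x (v : Fin (k + 1) → Tangent m x),
    (∃ i, v i ∈ F.leafTangent x) → α.d x v = 0

/-- Basic forms of pure type `(p,q)`. -/
structure IsBasicOfType (F : TransverselyHolomorphicFoliation m r M) (p q : ℕ)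
    (α : Form m M (p + q)) : Prop where
  basic : F.IsBasic α
  type : ∀ x, (α x).toAlternatingMap ∈ formsOfType (F.conormal10 x) p q

/-- Transverse positivity of a basic `(p,p)`-form, at every point of `M`. -/
def IsTransversePositive (F : TransverselyHolomorphicFoliation m r M) (p : ℕ) (hp : p ≤ r)
    (α : Form m M (p + p)) : Prop :=
  ∀ x, IsTransverseForm (F.conormal10 x) r p hp (α x).toAlternatingMap

end TransverselyHolomorphicFoliation

/-- The sesquilinear form `ū ᵗ H v` on `ℂʳ`. -/
def sesq {r : ℕ} (H : Matrix (Fin r) (Fin r) ℂ) (u v : Fin r → ℂ) : ℂ :=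
  dotProduct (star u) (H.mulVec v)

open scoped ComplexOrder in
/-- A transversely Hermitian foliation: a transversely holomorphic foliation with a smooth
Hermitian metric on each `π i (U i)`, invariant under the transition maps. -/
structure TransverselyHermitianFoliation (m r : ℕ) (M : Type*) [TopologicalSpace M]
    [ChartedSpace (EuclideanSpace ℝ (Fin m)) M] extends
    TransverselyHolomorphicFoliation m r M where
  /-- the Hermitian metrics on the open sets `π i (U i)` -/
  metric : Index → (Fin r → ℂ) → Matrix (Fin r) (Fin r) ℂ
  smooth_metric : ∀ i a b, ContDiffOn ℝ ∞ (fun z => metric i z a b) (π i '' U i)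
  posDef_metric : ∀ i, ∀ z ∈ π i '' U i, (metric i z).PosDef
  invariant_metric : ∀ i j, ∀ z ∈ π j '' (U i ∩ U j), ∀ u v : Fin r → ℂ,
    sesq (metric i (γ i j z)) (fderiv ℂ (γ i j) z u) (fderiv ℂ (γ i j) z v) = sesq (metric j z) u v

namespace TransverselyHermitianFoliation

variable {m r : ℕ} {M : Type*} [TopologicalSpace M] [ChartedSpace (EuclideanSpace ℝ (Fin m)) M]

/-- The transverse Hermitian metric as a sesquilinear form on the tangent space of `M` at `x`: the
pullback by `π i` of the metric on `π i (U i)`, for some (by invariance, any) `i` with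
`x ∈ U i`. -/
def transverseMetric (F : TransverselyHermitianFoliation m r M) (x : M) (v w : Tangent m x) : ℂ :=
  sesq (F.metric (F.cover x).choose (F.π (F.cover x).choose x))
    (F.dπ (F.cover x).choose x v) (F.dπ (F.cover x).choose x w)

end TransverselyHermitianFoliation

/-! ### Families -/

section Families

variable {m r : ℕ} {M : Type*} [TopologicalSpace M] [ChartedSpace (EuclideanSpace ℝ (Fin m)) M]
  {P : Type*} [NormedAddCommGroup P] [NormedSpace ℝ P]

/-- A family `F t`, `t ∈ U`, of transversely Hermitian structures is smooth: the bundles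
`N^*(F t)^{1,0}`, which determine the foliation and its transverse complex structure, have local
frames which are jointly smooth in the parameter and the point, and the transverse Hermitian
metrics are jointly smooth. Both are expressed in the charts of `M`. -/
structure IsSmoothFamily (U : Set P) (F : P → TransverselyHermitianFoliation m r M) : Prop where
  conormal : ∀ x₀ : M, ∀ t₀ ∈ U, ∀ y₀ ∈ chartTarget (m := m) x₀,
    ∃ (W : Set (P × EuclideanSpace ℝ (Fin m)))
      (θ : Fin r → P × EuclideanSpace ℝ (Fin m) → (EuclideanSpace ℝ (Fin m) →L[ℝ] ℂ)),
      IsOpen W ∧ (t₀, y₀) ∈ W ∧ W ⊆ U ×ˢ chartTarget x₀ ∧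
      (∀ k, ContDiffOn ℝ ∞ (θ k) W) ∧
      ∀ q ∈ W, Submodule.span ℂ (Set.range fun k => θ k q) =
        Submodule.span ℂ ((fun η : Tangent m (chartInv x₀ q.2) →L[ℝ] ℂ =>
          η.comp (chartInvDeriv x₀ q.2)) '' ((F q.1).conormal10 (chartInv x₀ q.2) : Set _))
  metric : ∀ (x₀ : M) (v w : EuclideanSpace ℝ (Fin m)), ContDiffOn ℝ ∞
    (fun q : P × EuclideanSpace ℝ (Fin m) => (F q.1).transverseMetric (chartInv x₀ q.2)
      (chartInvDeriv x₀ q.2 v) (chartInvDeriv x₀ q.2 w)) (U ×ˢ chartTarget x₀)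

/-- The family `F t`, `t ∈ U`, has fixed differentiable type: there is a smooth family of
diffeomorphisms `h t` of `M`, `t ∈ U`, with `(h t)^* (F t) = F 0` as foliations. -/
def HasFixedDifferentiableType (U : Set P) (F : P → TransverselyHermitianFoliation m r M) : Prop :=
  ∃ h : P → (M ≃ₘ⟮𝓡 m, 𝓡 m⟯ M),
    ContMDiffOn (𝓘(ℝ, P).prod (𝓡 m)) (𝓡 m) ∞ (fun q : P × M => h q.1 q.2) (U ×ˢ Set.univ) ∧
    ∀ t ∈ U, ∀ x : M, (F 0).leafTangent x =
      ((F t).leafTangent (h t x)).comap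
        (mfderiv (𝓡 m) (𝓡 m) (h t) x : Tangent m x →ₗ[ℝ] Tangent m (h t x))

end Families

end TransverseFoliation

end

/-!
Transversality at a point quantifies over a non-compact set of tuples `τ₁, …, τ_{r-p}`, and the
space `N^*𝓕_t^{1,0}_x` from which they are taken varies with `(t, x)`. Both difficulties disappear
after a choice of local frame `θ₁, …, θ_r` of `N^*𝓕_t^{1,0}`, smooth in `(t, x)`.

Writing `τ = b θ` with a matrix `b` of full rank `r - p`, orthonormalization gives `b = g c` with
`g` invertible and `c c* = 1` (`exists_eq_mul_orthonormalRows`), and replacing `b` by `c` divides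
`√-1 τ₁ ∧ τ̄₁ ∧ ⋯` by `|det g|² > 0` (`elementaryForm_sum_smul`). So only the compact set of
matrices `c` with orthonormal rows matters (`isCompact_orthonormalRows`).

A form `α` killed by contraction with leaf vectors gives
`α ∧ √-1 τ₁ ∧ τ̄₁ ∧ ⋯ = ρ √-1 θ₁ ∧ θ̄₁ ∧ ⋯ ∧ √-1 θ_r ∧ θ̄_r`, because
both sides are forms of degree `2r` on the normal space, which has real dimension `2r`
(`apply_mul_apply_comm_of_ker`). The factor `ρ` is real when `α` is, and it is the quotient of the
values of both forms on any vectors where the second does not vanish (`positivityRatio`). Hence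
`ρ` is continuous in `(t, x, c)`; its positivity at `t = 0` extends to nearby `(t, x)` by
compactness in `c` (`eventually_isTransverseForm`), and then uniformly in `x` by compactness
of `M`.
-/

open scoped Manifold ContDiff Topology ComplexConjugate

noncomputable section

namespace TransverseFoliation

/-! ### Wedge products and forms of top degree -/

section Wedge

variable {V V' : Type*} [AddCommGroup V] [Module ℝ V] [AddCommGroup V'] [Module ℝ V']

/-- The wedge product as a sum over `(k,l)`-shuffles, each represented by an arbitrary permutation
of its class. Naturality and continuity of `wedge` are read off from this formula. -/
theorem wedge_apply {k l : ℕ} (α : V [⋀^Fin k]→ₗ[ℝ] ℂ) (β : V [⋀^Fin l]→ₗ[ℝ] ℂ)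
    (v : Fin (k + l) → V) :
    wedge α β v = ∑ σ : Equiv.Perm.ModSumCongr (Fin k) (Fin l),
      Equiv.Perm.sign σ.out •
        (α (fun i => v (finSumFinEquiv (σ.out (Sum.inl i)))) *
          β (fun j => v (finSumFinEquiv (σ.out (Sum.inr j))))) := by
  simp only [wedge, AlternatingMap.domDomCongr_apply, LinearMap.compAlternatingMap_apply,
    AlternatingMap.domCoprod_apply, sum_apply, map_sum]
  refine Finset.sum_congr rfl fun σ _ => ?_
  conv_lhs => rw [← Quotient.out_eq' σ, AlternatingMap.domCoprod.summand_mk'']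
  simp only [smul_apply, MultilinearMap.domDomCongr_apply,
    MultilinearMap.domCoprod_apply, AlternatingMap.coe_multilinearMap]
  rw [Units.smul_def, Units.smul_def, map_zsmul]
  rfl

theorem wedge_compLinearMap {k l : ℕ} (α : V [⋀^Fin k]→ₗ[ℝ] ℂ) (β : V [⋀^Fin l]→ₗ[ℝ] ℂ)
    (f : V' →ₗ[ℝ] V) (v : Fin (k + l) → V') :
    wedge (α.compLinearMap f) (β.compLinearMap f) v = wedge α β (fun i => f (v i)) := by
  simp [wedge_apply]

theorem wedge_smul_right {k l : ℕ} (α : V [⋀^Fin k]→ₗ[ℝ] ℂ) (β : V [⋀^Fin l]→ₗ[ℝ] ℂ) (c : ℂ) :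
    wedge α (c • β) = c • wedge α β := by
  ext v
  simp [wedge_apply, Finset.mul_sum, Units.smul_def, mul_left_comm]

theorem wedge_eq_zero_of_mem {k l : ℕ} {α : V [⋀^Fin k]→ₗ[ℝ] ℂ} {β : V [⋀^Fin l]→ₗ[ℝ] ℂ}
    {L : Submodule ℝ V} (hα : ∀ v, (∃ i, v i ∈ L) → α v = 0)
    (hβ : ∀ v, (∃ i, v i ∈ L) → β v = 0) (v : Fin (k + l) → V) (hv : ∃ i, v i ∈ L) :
    wedge α β v = 0 := by
  rw [wedge_apply]
  refine Finset.sum_eq_zero fun σ _ => ?_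
  obtain ⟨i, hi⟩ := hv
  obtain ⟨s, rfl⟩ := (σ.out.trans finSumFinEquiv).surjective i
  rcases s with a | b
  · rw [hα _ ⟨a, hi⟩]; simp
  · rw [hβ _ ⟨b, hi⟩]; simp

theorem conj_wedge {k l : ℕ} {α : V [⋀^Fin k]→ₗ[ℝ] ℂ} {β : V [⋀^Fin l]→ₗ[ℝ] ℂ}
    (hα : ∀ v, conj (α v) = α v) (hβ : ∀ v, conj (β v) = β v) (v : Fin (k + l) → V) :
    conj (wedge α β v) = wedge α β v := by
  simp [wedge_apply, Units.smul_def, hα, hβ]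

/-- Alternating forms of degree `dim (V / ker Φ)` that vanish as soon as one argument lies in
`ker Φ` are proportional. -/
theorem apply_mul_apply_comm_of_ker {E : Type*} [AddCommGroup E] [Module ℝ E]
    [FiniteDimensional ℝ E] {n : ℕ} (hn : Module.finrank ℝ E = n) {Φ : V →ₗ[ℝ] E}
    (hΦ : Function.Surjective Φ) {α β : V [⋀^Fin n]→ₗ[ℝ] ℂ}
    (hα : ∀ v, (∃ i, v i ∈ LinearMap.ker Φ) → α v = 0)
    (hβ : ∀ v, (∃ i, v i ∈ LinearMap.ker Φ) → β v = 0) (v w : Fin n → V) :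
    α v * β w = α w * β v := by
  obtain ⟨s, hs⟩ := Φ.exists_rightInverse_of_surjective (LinearMap.range_eq_top.2 hΦ)
  have hsΦ : ∀ e, Φ (s e) = e := fun e => LinearMap.congr_fun hs e
  let e : Module.Basis (Fin n) ℝ E := Module.finBasisOfFinrankEq ℝ E hn
  -- A form killing `ker Φ` is the pullback of its restriction to a section of `Φ`.
  have factor : ∀ γ : V [⋀^Fin n]→ₗ[ℝ] ℂ, (∀ v, (∃ i, v i ∈ LinearMap.ker Φ) → γ v = 0) →
      ∀ v, γ v = γ (fun i => s (Φ (v i))) := by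
    intro γ hγ v
    have key : ∀ S : Finset (Fin n), γ (fun i => if i ∈ S then s (Φ (v i)) else v i) = γ v := by
      intro S
      induction S using Finset.induction_on with
      | empty => simp
      | insert a S ha ih =>
        rw [← ih]
        have e1 : (fun i => if i ∈ insert a S then s (Φ (v i)) else v i) =
            Function.update (fun i => if i ∈ S then s (Φ (v i)) else v i) a (s (Φ (v a))) := by
          ext i
          by_cases h : i = a
          · subst h; simp
          · simp [h]
        have e2 : (fun i => if i ∈ S then s (Φ (v i)) else v i) =
            Function.update (fun i => if i ∈ S then s (Φ (v i)) else v i) a (v a) := by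
          ext i
          by_cases h : i = a
          · subst h; simp [ha]
          · simp [h]
        conv_rhs => rw [e2]
        rw [e1, ← sub_eq_zero, ← AlternatingMap.map_update_sub]
        refine hγ _ ⟨a, ?_⟩
        simp [hsΦ]
    simpa using (key Finset.univ).symm
  -- A top form on `E` is determined by its value on a basis.
  have top : ∀ γ : V [⋀^Fin n]→ₗ[ℝ] ℂ, (∀ v, (∃ i, v i ∈ LinearMap.ker Φ) → γ v = 0) →
      ∀ v, γ v = (e.det (fun i => Φ (v i)) : ℂ) * γ (fun i => s (e i)) := by
    intro γ hγ v
    have h : γ.compLinearMap s =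
        (LinearMap.toSpanSingleton ℝ ℂ (γ fun i => s (e i))).compAlternatingMap e.det := by
      refine Module.Basis.ext_alternating e fun i hi => ?_
      let σ : Equiv.Perm (Fin n) := Equiv.ofBijective i (Finite.injective_iff_bijective.1 hi)
      change γ ((fun j => s (e j)) ∘ σ) =
        (LinearMap.toSpanSingleton ℝ ℂ (γ fun i => s (e i))) (e.det (e ∘ σ))
      rw [AlternatingMap.map_perm, AlternatingMap.map_perm, Module.Basis.det_self]
      simp [Units.smul_def]
    rw [factor γ hγ v]
    have := congrArg (fun δ => δ fun i => Φ (v i)) h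
    simpa using this
  rw [top α hα v, top β hβ w, top α hα w, top β hβ v]
  ring

end Wedge

/-! ### Elementary forms of covectors -/

section Elementary

variable {V V' : Type*} [AddCommGroup V] [Module ℝ V] [TopologicalSpace V]
  [AddCommGroup V'] [Module ℝ V'] [TopologicalSpace V']

theorem wedgeCovectors_apply {n : ℕ} (θ : Fin n → (V →L[ℝ] ℂ)) (v : Fin n → V) :
    wedgeCovectors θ v = Matrix.det (Matrix.of fun i j => θ j (v i)) := rfl

/-- The matrix with entries `(θ_j (v_a), θ̄_j (v_a))`, whose determinant is, up to a power of `√-1`,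
the value of `elementaryForm θ` at `v`. -/
def evalMatrix {q : ℕ} (θ : Fin q → (V →L[ℝ] ℂ)) (v : Fin (q * 2) → V) :
    Matrix (Fin q × Fin 2) (Fin q × Fin 2) ℂ :=
  Matrix.of fun a b => ![θ b.1 (v (finProdFinEquiv a)), conj (θ b.1 (v (finProdFinEquiv a)))] b.2

theorem elementaryForm_apply {q : ℕ} (θ : Fin q → (V →L[ℝ] ℂ)) (v : Fin (q * 2) → V) :
    elementaryForm θ v = Complex.I ^ q * (evalMatrix θ v).det := by
  rw [elementaryForm, AlternatingMap.smul_apply, wedgeCovectors_apply, smul_eq_mul,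
    ← Matrix.det_submatrix_equiv_self finProdFinEquiv.symm (evalMatrix θ v)]
  congr 2
  ext a b
  simp only [evalMatrix, Matrix.submatrix_apply, Matrix.of_apply, Equiv.apply_symm_apply]
  generalize (finProdFinEquiv.symm b) = c
  obtain ⟨c, s⟩ := c
  fin_cases s <;> rfl

theorem elementaryForm_compLinearMap {q : ℕ} (θ : Fin q → (V →L[ℝ] ℂ)) (f : V' →L[ℝ] V) :
    elementaryForm (fun k => (θ k).comp f) = (elementaryForm θ).compLinearMap (f : V' →ₗ[ℝ] V) := by
  ext v
  rw [AlternatingMap.compLinearMap_apply, elementaryForm_apply, elementaryForm_apply]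
  rfl

theorem elementaryForm_eq_zero {q : ℕ} (θ : Fin q → (V →L[ℝ] ℂ)) (v : Fin (q * 2) → V)
    (hv : ∃ i, ∀ k, θ k (v i) = 0) : elementaryForm θ v = 0 := by
  obtain ⟨i, hi⟩ := hv
  obtain ⟨a, rfl⟩ := finProdFinEquiv.surjective i
  rw [elementaryForm_apply, Matrix.det_eq_zero_of_row_eq_zero a, mul_zero]
  rintro ⟨j, s⟩
  fin_cases s <;> simp [evalMatrix, hi]

/-- Elementary forms are real: conjugation interchanges `τ_k` and `τ̄_k`, and the resulting sign
`(-1)^q` is that of `conj (√-1 ^ q)`. -/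
theorem conj_elementaryForm {q : ℕ} (θ : Fin q → (V →L[ℝ] ℂ)) (v : Fin (q * 2) → V) :
    conj (elementaryForm θ v) = elementaryForm θ v := by
  let e : Equiv.Perm (Fin q × Fin 2) := (Equiv.refl (Fin q)).prodCongr (Equiv.swap 0 1)
  have hdet : conj (evalMatrix θ v).det = (-1) ^ q * (evalMatrix θ v).det := by
    have h1 : (evalMatrix θ v).map (starRingEnd ℂ) = (evalMatrix θ v).submatrix id e := by
      ext a ⟨b, s⟩
      fin_cases s <;> simp [evalMatrix, e]
    have h2 : Equiv.Perm.sign e = (-1) ^ q := by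
      rw [show e = Equiv.prodCongrRight fun _ => Equiv.swap 0 1 from rfl,
        Equiv.Perm.sign_prodCongrRight]
      simp
    rw [RingHom.map_det]
    change ((evalMatrix θ v).map (starRingEnd ℂ)).det = _
    rw [h1, Matrix.det_permute', h2]
    simp
  rw [elementaryForm_apply, map_mul, hdet, map_pow, Complex.conj_I, ← mul_assoc, ← mul_pow]
  simp

/-- Change of frame multiplies an elementary form by `|det g|²`. -/
theorem elementaryForm_sum_smul {q : ℕ} (g : Matrix (Fin q) (Fin q) ℂ)
    (θ : Fin q → (V →L[ℝ] ℂ)) :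
    elementaryForm (fun j => ∑ k, g j k • θ k) = (Complex.normSq g.det : ℂ) • elementaryForm θ := by
  ext v
  have h : evalMatrix (fun j => ∑ k, g j k • θ k) v = evalMatrix θ v *
      Matrix.blockDiagonal fun s : Fin 2 => ![g.transpose, g.conjTranspose] s := by
    ext a ⟨b, s⟩
    rw [Matrix.mul_apply, Fintype.sum_prod_type]
    fin_cases s <;> simp [evalMatrix, Matrix.blockDiagonal_apply, mul_comm]
  rw [AlternatingMap.smul_apply, elementaryForm_apply, elementaryForm_apply, h, Matrix.det_mul,
    Matrix.det_blockDiagonal]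
  simp [Matrix.det_conjTranspose, Complex.mul_conj, smul_eq_mul]
  ring

/-- The real-linear map `V → ℂʳ` with components `θ`. -/
def frameMap {r : ℕ} (θ : Fin r → (V →L[ℝ] ℂ)) : V →ₗ[ℝ] (Fin r → ℂ) :=
  LinearMap.pi fun k => (θ k : V →ₗ[ℝ] ℂ)

theorem frameMap_apply {r : ℕ} (θ : Fin r → (V →L[ℝ] ℂ)) (v : V) (k : Fin r) :
    frameMap θ v k = θ k v := rfl

theorem mem_ker_frameMap {r : ℕ} {θ : Fin r → (V →L[ℝ] ℂ)} {v : V} :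
    v ∈ LinearMap.ker (frameMap θ) ↔ ∀ k, θ k v = 0 := by
  rw [LinearMap.mem_ker, funext_iff]; rfl

/-- The volume form of a frame does not vanish identically. -/
theorem exists_elementaryForm_ne_zero {r : ℕ} {θ : Fin r → (V →L[ℝ] ℂ)}
    (hθ : Function.Surjective (frameMap θ)) : ∃ v, elementaryForm θ v ≠ 0 := by
  -- Vectors whose images in `ℂʳ` are the real basis `e₁, √-1 e₁, e₂, √-1 e₂, …`.
  choose s hs using hθ
  have hs' : ∀ z k, θ k (s z) = z k := fun z k => congrFun (hs z) k
  refine ⟨fun a => s (Pi.single (finProdFinEquiv.symm a).1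
    (![1, Complex.I] (finProdFinEquiv.symm a).2)), ?_⟩
  rw [elementaryForm_apply]
  refine mul_ne_zero (pow_ne_zero _ Complex.I_ne_zero) ?_
  have h : evalMatrix θ (fun a => s (Pi.single (finProdFinEquiv.symm a).1
      (![1, Complex.I] (finProdFinEquiv.symm a).2))) =
      (Matrix.blockDiagonal fun _ : Fin r => !![1, 1; Complex.I, -Complex.I]).submatrix
        (Equiv.prodComm _ _) (Equiv.prodComm _ _) := by
    ext ⟨a, s⟩ ⟨b, t⟩
    simp only [evalMatrix, Matrix.of_apply, hs', Equiv.symm_apply_apply, Matrix.submatrix_apply,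
      Matrix.blockDiagonal_apply, Equiv.prodComm_apply, Prod.swap, Pi.single_apply]
    by_cases hab : a = b
    · subst hab; fin_cases s <;> fin_cases t <;> simp
    · have hba : ¬ b = a := fun h => hab h.symm
      fin_cases t <;> simp [hab, hba]
  rw [h, Matrix.det_submatrix_equiv_self, Matrix.det_blockDiagonal]
  refine Finset.prod_ne_zero_iff.2 fun _ _ => ?_
  rw [Matrix.det_fin_two_of]
  intro h0
  have := congrArg Complex.im h0
  norm_num at this

end Elementary

/-! ### Orthonormal tuples in `ℂʳ` -/

section Gram

/-- The space of `q`-tuples of orthonormal vectors in `ℂʳ`, written as the rows of a `q × r`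
matrix. -/
def orthonormalRows (q r : ℕ) : Set (Matrix (Fin q) (Fin r) ℂ) :=
  {c | c * c.conjTranspose = 1}

theorem isCompact_orthonormalRows (q r : ℕ) : IsCompact (orthonormalRows q r) := by
  have hK : IsCompact (Set.univ.pi fun _ => Set.univ.pi fun _ => Metric.closedBall 0 1 :
      Set (Fin q → Fin r → ℂ)) :=
    isCompact_univ_pi fun _ => isCompact_univ_pi fun _ => isCompact_closedBall 0 1
  refine IsCompact.of_isClosed_subset hK ?_ ?_
  · exact isClosed_eq (by fun_prop) continuous_const
  · intro c hc i _ j _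
    have h1 : ∑ k, Complex.normSq (c i k) = 1 := by
      have := congrFun (congrFun hc i) i
      simp only [Matrix.mul_apply, Matrix.conjTranspose_apply, Matrix.one_apply_eq,
        RCLike.star_def, Complex.mul_conj] at this
      exact_mod_cast this
    have h2 : Complex.normSq (c i j) ≤ 1 := h1 ▸
      Finset.single_le_sum (f := fun k => Complex.normSq (c i k))
        (fun k _ => Complex.normSq_nonneg _) (Finset.mem_univ j)
    rw [Complex.normSq_eq_norm_sq] at h2
    rw [mem_closedBall_zero_iff]
    nlinarith [norm_nonneg (c i j)]

theorem vecMul_injective_of_mem_orthonormalRows {q r : ℕ} {c : Matrix (Fin q) (Fin r) ℂ}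
    (hc : c ∈ orthonormalRows q r) : Function.Injective c.vecMul := by
  intro x y hxy
  have h := congrArg (fun z => Matrix.vecMul z c.conjTranspose) hxy
  have hc' : c * c.conjTranspose = 1 := hc
  simpa [Matrix.vecMul_vecMul, hc'] using h

open scoped MatrixOrder ComplexOrder in
/-- Orthonormalization of the rows of a matrix: `b = g c` with `g` invertible and `c` having
orthonormal rows, where `g` comes from a factorization `b b* = g g*`. -/
theorem exists_eq_mul_orthonormalRows {q r : ℕ} {b : Matrix (Fin q) (Fin r) ℂ}
    (hb : Function.Injective b.vecMul) :
    ∃ (g : Matrix (Fin q) (Fin q) ℂ) (c : Matrix (Fin q) (Fin r) ℂ),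
      g.det ≠ 0 ∧ c ∈ orthonormalRows q r ∧ b = g * c := by
  obtain ⟨g, hg, hbg⟩ := CStarAlgebra.isStrictlyPositive_iff_eq_mul_star_self.1
    (Matrix.PosDef.mul_conjTranspose_self b hb).isStrictlyPositive
  have hdet : IsUnit g.det := (Matrix.isUnit_iff_isUnit_det g).1 hg
  have hdet' : IsUnit g.conjTranspose.det := by
    rw [Matrix.det_conjTranspose]; exact hdet.star
  refine ⟨g, g⁻¹ * b, hdet.ne_zero, ?_, ?_⟩
  · change g⁻¹ * b * (g⁻¹ * b).conjTranspose = 1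
    rw [Matrix.conjTranspose_mul, Matrix.mul_assoc, ← Matrix.mul_assoc b, hbg,
      Matrix.star_eq_conjTranspose, Matrix.mul_assoc, ← Matrix.mul_assoc g⁻¹,
      Matrix.nonsing_inv_mul _ hdet, Matrix.one_mul, Matrix.conjTranspose_nonsing_inv,
      Matrix.mul_nonsing_inv _ hdet']
  · rw [Matrix.mul_nonsing_inv_cancel_left _ _ hdet]

end Gram

/-! ### A criterion for transversality on a compact set of tuples -/

section Criterion

variable {V : Type*} [AddCommGroup V] [Module ℝ V] [TopologicalSpace V]

theorem linearIndependent_of_frameMap_surjective {r : ℕ} {θ : Fin r → (V →L[ℝ] ℂ)}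
    (hθ : Function.Surjective (frameMap θ)) : LinearIndependent ℂ θ := by
  rw [Fintype.linearIndependent_iff]
  intro g hg i
  obtain ⟨v, hv⟩ := hθ (Pi.single i 1)
  have h := congrArg (fun η : V →L[ℝ] ℂ => η v) hg
  simpa [← frameMap_apply, hv, Pi.single_apply] using h

theorem linearIndependent_sum_smul_iff {q r : ℕ} {θ : Fin r → (V →L[ℝ] ℂ)}
    (hθ : LinearIndependent ℂ θ) (b : Matrix (Fin q) (Fin r) ℂ) :
    LinearIndependent ℂ (fun j => ∑ k, b j k • θ k) ↔ Function.Injective b.vecMul := by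
  rw [Matrix.vecMul_injective_iff]
  exact (Fintype.linearCombination ℂ θ).linearIndependent_iff_of_injOn
    ((linearIndependent_iff_injective_fintypeLinearCombination.1 hθ).injOn) (v := b.row)

theorem exists_eq_sum_smul {q r : ℕ} {θ : Fin r → (V →L[ℝ] ℂ)} {τ : Fin q → (V →L[ℝ] ℂ)}
    (hτ : ∀ j, τ j ∈ Submodule.span ℂ (Set.range θ)) :
    ∃ b : Matrix (Fin q) (Fin r) ℂ, τ = fun j => ∑ k, b j k • θ k := by
  choose b hb using fun j => (Submodule.mem_span_range_iff_exists_fun ℂ).1 (hτ j)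
  exact ⟨Matrix.of b, funext fun j => (hb j).symm⟩

/-- If the span of `r` covectors `θ` contains `ψ₁, …, ψ_r` with `frameMap ψ` surjective, then
`ψ = b θ` with `b` invertible, and `frameMap θ` is surjective too. -/
theorem frameMap_surjective_of_mem_span {r : ℕ} {θ ψ : Fin r → (V →L[ℝ] ℂ)}
    (hψ : Function.Surjective (frameMap ψ))
    (h : ∀ j, ψ j ∈ Submodule.span ℂ (Set.range θ)) : Function.Surjective (frameMap θ) := by
  obtain ⟨b, rfl⟩ := exists_eq_sum_smul h
  have hb : ∀ v, frameMap (fun j => ∑ k, b j k • θ k) v = b.mulVec (frameMap θ v) := by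
    intro v
    ext j
    simp [frameMap_apply, Matrix.mulVec, dotProduct]
  have hsurj : Function.Surjective b.mulVec := fun z =>
    (hψ z).imp' (frameMap θ) fun v hv => by rw [← hb, hv]
  have hinj : Function.Injective b.mulVec :=
    LinearMap.injective_iff_surjective (f := b.mulVecLin).2 hsurj
  intro z
  obtain ⟨v, hv⟩ := hψ (b.mulVec z)
  exact ⟨v, hinj (by rw [← hb, hv])⟩

/-- A strictly positive volume is a positive multiple of the elementary form of every frame. -/
theorem IsStrictlyPositiveVolume.exists_smul_of_frame {r n : ℕ} {hn : r * 2 = n}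
    {θ : Fin r → (V →L[ℝ] ℂ)} {η : V [⋀^Fin n]→ₗ[ℝ] ℂ} (hθ : LinearIndependent ℂ θ)
    (h : IsStrictlyPositiveVolume (Submodule.span ℂ (Set.range θ)) r hn η) :
    ∃ c : ℝ, 0 < c ∧ η = (c : ℂ) • (elementaryForm θ).domDomCongr (finCongr hn) := by
  obtain ⟨ψ, hψ, hspan, c, hc, rfl⟩ := h
  obtain ⟨g, rfl⟩ := exists_eq_sum_smul (θ := θ) (τ := ψ)
    fun j => hspan ▸ Submodule.subset_span ⟨j, rfl⟩
  rw [linearIndependent_sum_smul_iff hθ, Matrix.vecMul_injective_iff_isUnit,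
    Matrix.isUnit_iff_isUnit_det] at hψ
  refine ⟨c * Complex.normSq g.det, mul_pos hc (Complex.normSq_pos.2 hψ.ne_zero), ?_⟩
  rw [elementaryForm_sum_smul]
  ext v
  simp [mul_assoc]

/-- The ratio of `α ∧ √-1 τ₁ ∧ τ̄₁ ∧ ⋯` with `τ = c θ` to the volume form of the frame `θ`,
computed on the vectors `v`. -/
def positivityRatio {r p : ℕ} (hp : p ≤ r) (α : V [⋀^Fin (p + p)]→ₗ[ℝ] ℂ)
    (θ : Fin r → (V →L[ℝ] ℂ)) (c : Matrix (Fin (r - p)) (Fin r) ℂ)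
    (v : Fin (p + p + (r - p) * 2) → V) : ℂ :=
  wedge α (elementaryForm fun j => ∑ k, c j k • θ k) v /
    (elementaryForm θ).domDomCongr
      (finCongr (by omega : r * 2 = p + p + (r - p) * 2)) v

/-- Positivity of the ratio on the compact set of orthonormal tuples implies transversality: an
arbitrary linearly independent tuple `g c θ` changes the ratio by the factor `|det g|²` only. -/
theorem isTransverseForm_of_positivityRatio {r p : ℕ} (hp : p ≤ r)
    {α : V [⋀^Fin (p + p)]→ₗ[ℝ] ℂ} {θ : Fin r → (V →L[ℝ] ℂ)}
    (hθ : Function.Surjective (frameMap θ)) (hα : ∀ v, conj (α v) = α v)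
    (hker : ∀ v, (∃ i, ∀ k, θ k (v i) = 0) → α v = 0)
    {v : Fin (p + p + (r - p) * 2) → V}
    (hv : (elementaryForm θ).domDomCongr
      (finCongr (by omega : r * 2 = p + p + (r - p) * 2)) v ≠ 0)
    (hpos : ∀ c ∈ orthonormalRows (r - p) r, 0 < (positivityRatio hp α θ c v).re) :
    IsTransverseForm (Submodule.span ℂ (Set.range θ)) r p hp α := by
  intro τ hτ hτi
  have hli := linearIndependent_of_frameMap_surjective hθ
  obtain ⟨b, rfl⟩ := exists_eq_sum_smul hτ
  obtain ⟨g, c, hg, hc, rfl⟩ := exists_eq_mul_orthonormalRows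
    ((linearIndependent_sum_smul_iff hli b).1 hτi)
  have hbc : (fun j => ∑ k, (g * c) j k • θ k) =
      fun j => ∑ l, g j l • ∑ k, c l k • θ k := by
    funext j
    simp only [Matrix.mul_apply, Finset.smul_sum, smul_smul]
    rw [Finset.sum_comm]
    refine Finset.sum_congr rfl fun k _ => ?_
    ext w
    simp [Finset.sum_mul]
  set ρ := positivityRatio hp α θ c v with hρ
  set E := (elementaryForm θ).domDomCongr (finCongr (by omega : r * 2 = p + p + (r - p) * 2))
    with hE
  set β := wedge α (elementaryForm fun j => ∑ k, c j k • θ k) with hβ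
  have hEreal : conj (E v) = E v := conj_elementaryForm θ _
  have hβreal : conj (β v) = β v := conj_wedge hα (conj_elementaryForm _) v
  -- Numerator and denominator are real, so positivity of the real part is positivity.
  have hρreal : (ρ.re : ℂ) = ρ := by
    rw [← Complex.conj_eq_iff_re, hρ, positivityRatio, map_div₀, hEreal, hβreal]
  have hβE : β = (ρ.re : ℂ) • E := by
    ext w
    have hfin : Module.finrank ℝ (Fin r → ℂ) = p + p + (r - p) * 2 := by
      rw [Module.finrank_pi_fintype]
      simp [Complex.finrank_real_complex]
      omega
    have := apply_mul_apply_comm_of_ker hfin hθ (α := β) (β := E) ?_ ?_ v w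
    · rw [hρreal, AlternatingMap.smul_apply, smul_eq_mul, hρ, positivityRatio, ← hE, ← hβ,
        div_mul_eq_mul_div, this, mul_div_cancel_right₀ _ hv]
    · refine wedge_eq_zero_of_mem (L := LinearMap.ker (frameMap θ)) ?_ ?_
      · exact fun v ⟨i, hi⟩ => hker v ⟨i, mem_ker_frameMap.1 hi⟩
      · refine fun v ⟨i, hi⟩ => elementaryForm_eq_zero _ v ⟨i, fun j => ?_⟩
        simp [mem_ker_frameMap.1 hi]
    · rintro v ⟨i, hi⟩
      exact elementaryForm_eq_zero _ _ ⟨(finCongr (by omega)).symm i, fun j => by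
        simpa using mem_ker_frameMap.1 hi j⟩
  refine ⟨θ, hli, rfl, Complex.normSq g.det * ρ.re,
    mul_pos (Complex.normSq_pos.2 hg) (hpos c hc), ?_⟩
  rw [hbc, elementaryForm_sum_smul, wedge_smul_right, ← hβ, hβE, smul_smul, Complex.ofReal_mul]

theorem IsTransverseForm.positivityRatio_pos {r p : ℕ} {hp : p ≤ r}
    {α : V [⋀^Fin (p + p)]→ₗ[ℝ] ℂ} {θ : Fin r → (V →L[ℝ] ℂ)} (hθ : LinearIndependent ℂ θ)
    (h : IsTransverseForm (Submodule.span ℂ (Set.range θ)) r p hp α)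
    {v : Fin (p + p + (r - p) * 2) → V}
    (hv : (elementaryForm θ).domDomCongr
      (finCongr (by omega : r * 2 = p + p + (r - p) * 2)) v ≠ 0)
    {c : Matrix (Fin (r - p)) (Fin r) ℂ} (hc : c ∈ orthonormalRows (r - p) r) :
    0 < (positivityRatio hp α θ c v).re := by
  obtain ⟨κ, hκ, h⟩ := (h (fun j => ∑ k, c j k • θ k)
    (fun j => Submodule.sum_mem _ fun k _ =>
      Submodule.smul_mem _ _ (Submodule.subset_span ⟨k, rfl⟩))
    ((linearIndependent_sum_smul_iff hθ c).2
      (vecMul_injective_of_mem_orthonormalRows hc))).exists_smul_of_frame hθ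
  rw [positivityRatio, h, AlternatingMap.smul_apply, smul_eq_mul, mul_div_cancel_right₀ _ hv]
  simpa using hκ

theorem positivityRatio_comp {V' : Type*} [AddCommGroup V'] [Module ℝ V'] [TopologicalSpace V']
    {r p : ℕ} (hp : p ≤ r) (α : V [⋀^Fin (p + p)]→ₗ[ℝ] ℂ)
    (θ : Fin r → (V →L[ℝ] ℂ)) (c : Matrix (Fin (r - p)) (Fin r) ℂ) (f : V' →L[ℝ] V)
    (v : Fin (p + p + (r - p) * 2) → V') :
    positivityRatio hp (α.compLinearMap (f : V' →ₗ[ℝ] V)) (fun k => (θ k).comp f) c v =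
      positivityRatio hp α θ c fun i => f (v i) := by
  have h : (fun j => ∑ k, c j k • (θ k).comp f) = fun j => (∑ k, c j k • θ k).comp f := by
    ext j w
    simp
  rw [positivityRatio, h, elementaryForm_compLinearMap, elementaryForm_compLinearMap,
    wedge_compLinearMap]
  rfl

end Criterion

/-! ### Continuity in parameters -/

section Continuity

variable {E : Type*} [NormedAddCommGroup E] [NormedSpace ℝ E] {X : Type*} [TopologicalSpace X]

theorem continuousAt_elementaryForm {q : ℕ} {θ : X → Fin q → (E →L[ℝ] ℂ)} {x : X}
    (hθ : ∀ k, ContinuousAt (fun x => θ x k) x) (v : Fin (q * 2) → E) :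
    ContinuousAt (fun x => elementaryForm (θ x) v) x := by
  simp only [elementaryForm_apply]
  refine continuousAt_const.mul ?_
  have h : ContinuousAt (fun x => evalMatrix (θ x) v) x := by
    refine continuousAt_pi.2 fun a => continuousAt_pi.2 fun ⟨b, s⟩ => ?_
    have h1 : ContinuousAt (fun x => θ x b (v (finProdFinEquiv a))) x :=
      (hθ b).clm_apply continuousAt_const
    fin_cases s
    · exact h1
    · exact Complex.continuous_conj.continuousAt.comp h1
  exact (Continuous.matrix_det continuous_id).continuousAt.comp h

theorem continuousAt_positivityRatio {r p : ℕ} (hp : p ≤ r)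
    {α : X → E [⋀^Fin (p + p)]→L[ℝ] ℂ} {θ : X → Fin r → (E →L[ℝ] ℂ)}
    {c : X → Matrix (Fin (r - p)) (Fin r) ℂ} {x : X} (hα : ContinuousAt α x)
    (hθ : ∀ k, ContinuousAt (fun x => θ x k) x) (hc : ContinuousAt c x)
    {v : Fin (p + p + (r - p) * 2) → E}
    (hv : (elementaryForm (θ x)).domDomCongr
      (finCongr (by omega : r * 2 = p + p + (r - p) * 2)) v ≠ 0) :
    ContinuousAt (fun x => positivityRatio hp (α x).toAlternatingMap (θ x) (c x) v) x := by
  refine ContinuousAt.div ?_ (continuousAt_elementaryForm hθ _) hv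
  have hτ : ∀ j, ContinuousAt (fun x => ∑ k, c x j k • θ x k) x := fun j =>
    tendsto_finsetSum _ fun k _ =>
      (((continuous_apply_apply j k).continuousAt.comp hc : ContinuousAt (fun x => c x j k) x)).smul
        (hθ k)
  simp only [wedge_apply, Units.smul_def]
  refine tendsto_finsetSum _ fun σ _ => ContinuousAt.const_smul (ContinuousAt.mul ?_ ?_) _
  · exact ((ContinuousAlternatingMap.apply ℝ E ℂ _).continuous.continuousAt.comp hα :)
  · exact continuousAt_elementaryForm hτ _

end Continuity

/-! ### The conormal bundle of a transversely holomorphic foliation -/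

section Foliation

variable {m r : ℕ} {M : Type*} [TopologicalSpace M] [ChartedSpace (EuclideanSpace ℝ (Fin m)) M]

namespace TransverselyHolomorphicFoliation

theorem frameMap_dz_surjective (F : TransverselyHolomorphicFoliation m r M) {i : F.Index} {x : M}
    (hi : x ∈ F.U i) : Function.Surjective (frameMap fun k => F.dz i k x) :=
  F.submersion_π i x hi

/-- The differentials of two local submersions differ by the complex-linear differential of the
transition map. -/
theorem exists_dπ_eq (F : TransverselyHolomorphicFoliation m r M) {i j : F.Index} {x : M}
    (hi : x ∈ F.U i) (hj : x ∈ F.U j) :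
    ∃ A : (Fin r → ℂ) →L[ℂ] (Fin r → ℂ), ∀ v, F.dπ i x v = A (F.dπ j x v) := by
  have hU : F.U i ∩ F.U j ∈ 𝓝 x :=
    ((F.isOpen_U i).inter (F.isOpen_U j)).mem_nhds ⟨hi, hj⟩
  have hdj : MDifferentiableAt (𝓡 m) 𝓘(ℝ, Fin r → ℂ) (F.π j) x :=
    ((F.smooth_π j).contMDiffAt ((F.isOpen_U j).mem_nhds hj)).mdifferentiableAt (by simp)
  obtain ⟨A, hA⟩ := F.holomorphic_γ i j (F.π j x) ⟨x, ⟨hi, hj⟩, rfl⟩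
  refine ⟨A, fun v => ?_⟩
  have h1 : HasMFDerivWithinAt 𝓘(ℝ, Fin r → ℂ) 𝓘(ℝ, Fin r → ℂ) (F.γ i j)
      (F.π j '' (F.U i ∩ F.U j)) (F.π j x) (A.restrictScalars ℝ) :=
    (hA.restrictScalars ℝ).hasMFDerivWithinAt
  have h2 := h1.comp x hdj.hasMFDerivAt.hasMFDerivWithinAt (Set.subset_preimage_image _ _)
  have h3 : HasMFDerivAt (𝓡 m) 𝓘(ℝ, Fin r → ℂ) (F.π i) x _ :=
    (h2.hasMFDerivAt hU).congr_of_eventuallyEq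
      (Filter.eventuallyEq_of_mem hU fun y hy => F.cocycle i j y hy)
  change mfderiv (𝓡 m) 𝓘(ℝ, Fin r → ℂ) (F.π i) x v = _
  rw [h3.mfderiv]
  rfl

theorem conormal10_eq_span (F : TransverselyHolomorphicFoliation m r M) {j : F.Index} {x : M}
    (hj : x ∈ F.U j) :
    F.conormal10 x = Submodule.span ℂ (Set.range fun k => F.dz j k x) := by
  refine le_antisymm (iSup₂_le fun i hi => Submodule.span_le.2 ?_)
    (le_iSup₂_of_le j hj le_rfl)
  rintro _ ⟨k, rfl⟩
  obtain ⟨A, hA⟩ := F.exists_dπ_eq hi hj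
  refine (Submodule.mem_span_range_iff_exists_fun ℂ).2
    ⟨fun l => A (Pi.single l 1) k, ?_⟩
  ext v
  have h1 : F.dz i k x v = A (F.dπ j x v) k := congrFun (hA v) k
  have h2 : A (F.dπ j x v) = ∑ l, F.dπ j x v l • A (Pi.single l 1) := by
    conv_lhs => rw [pi_eq_sum_univ' (F.dπ j x v)]
    simp [map_sum]
  rw [h1, h2]
  simp [mul_comm]
  rfl

/-- A vector annihilated by a frame of `N^*𝓕^{1,0}` is tangent to the leaf. -/
theorem mem_leafTangent_of_frame (F : TransverselyHolomorphicFoliation m r M) {x : M}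
    {θ : Fin r → (Tangent m x →L[ℝ] ℂ)} (hθ : Submodule.span ℂ (Set.range θ) = F.conormal10 x)
    {v : Tangent m x} (hv : ∀ k, θ k v = 0) : v ∈ F.leafTangent x := by
  refine (Submodule.mem_iInf _).2 fun i => (Submodule.mem_iInf _).2 fun hi => ?_
  have hW : ∀ η ∈ F.conormal10 x, η v = 0 := by
    intro η hη
    rw [← hθ] at hη
    obtain ⟨c, rfl⟩ := (Submodule.mem_span_range_iff_exists_fun ℂ).1 hη
    simp [hv]
  rw [LinearMap.mem_ker]
  ext k
  refine hW (F.dz i k x) ?_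
  rw [F.conormal10_eq_span hi]
  exact Submodule.subset_span ⟨k, rfl⟩

theorem frameMap_surjective_of_span_eq (F : TransverselyHolomorphicFoliation m r M) {x : M}
    {θ : Fin r → (Tangent m x →L[ℝ] ℂ)} (hθ : Submodule.span ℂ (Set.range θ) = F.conormal10 x) :
    Function.Surjective (frameMap θ) := by
  obtain ⟨i, hi⟩ := F.cover x
  refine frameMap_surjective_of_mem_span (F.frameMap_dz_surjective hi) fun k => ?_
  rw [hθ, F.conormal10_eq_span hi]
  exact Submodule.subset_span ⟨k, rfl⟩

end TransverselyHolomorphicFoliation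

end Foliation

/-! ### Expression in charts -/

section Pullback

variable {V V' : Type*} [AddCommGroup V] [Module ℝ V] [TopologicalSpace V]
  [AddCommGroup V'] [Module ℝ V'] [TopologicalSpace V']

/-- A frame of the pullback of a space of covectors under an isomorphism, transported back by the
inverse, is a frame of the original space. -/
theorem span_comp_symm_eq {r : ℕ} (D : V' ≃L[ℝ] V) {W : Submodule ℂ (V →L[ℝ] ℂ)}
    {θ : Fin r → (V' →L[ℝ] ℂ)}
    (hθ : Submodule.span ℂ (Set.range θ) =
      Submodule.span ℂ ((fun η : V →L[ℝ] ℂ => η.comp (D : V' →L[ℝ] V)) '' (W : Set _))) :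
    Submodule.span ℂ (Set.range fun k => (θ k).comp (D.symm : V →L[ℝ] V')) = W := by
  let P : (V' →L[ℝ] ℂ) →ₗ[ℂ] (V →L[ℝ] ℂ) :=
    { toFun := fun η => η.comp (D.symm : V →L[ℝ] V')
      map_add' := fun _ _ => rfl
      map_smul' := fun _ _ => rfl }
  have h := congrArg (Submodule.map P) hθ
  rw [Submodule.map_span, Submodule.map_span, ← Set.range_comp, ← Set.image_comp] at h
  have hid : (P ∘ fun η : V →L[ℝ] ℂ => η.comp (D : V' →L[ℝ] V)) = id := by
    funext η
    ext v
    exact congrArg η (D.apply_symm_apply v)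
  rw [hid, Set.image_id, Submodule.span_eq] at h
  exact h

end Pullback

/-! ### Openness in the parameter and the point -/

section Openness

variable {m r p : ℕ} {M : Type*} [TopologicalSpace M]
  [ChartedSpace (EuclideanSpace ℝ (Fin m)) M]

theorem chartInvDeriv_isInvertible [IsManifold (𝓡 m) ∞ M] {x₀ : M} {y : EuclideanSpace ℝ (Fin m)}
    (hy : y ∈ chartTarget (m := m) x₀) : (chartInvDeriv x₀ y).IsInvertible := by
  have : IsManifold (𝓡 m) 1 M := IsManifold.of_le (n := ∞) (by simp)
  have h := isInvertible_mfderivWithin_extChartAt_symm (I := 𝓡 m) hy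
  rwa [modelWithCornersSelf_coe, Set.range_id, mfderivWithin_univ] at h

/-- A frame, in the chart `φ`, of the conormal bundle at `φ⁻¹(y)` comes from a frame on `M`. -/
theorem exists_frame_of_chart [IsManifold (𝓡 m) ∞ M] {x₀ : M} {y : EuclideanSpace ℝ (Fin m)}
    (hy : y ∈ chartTarget (m := m) x₀)
    {W : Submodule ℂ (Tangent m (chartInv x₀ y) →L[ℝ] ℂ)}
    {θ : Fin r → (EuclideanSpace ℝ (Fin m) →L[ℝ] ℂ)}
    (hθ : Submodule.span ℂ (Set.range θ) =
      Submodule.span ℂ ((fun η : Tangent m (chartInv x₀ y) →L[ℝ] ℂ =>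
        η.comp (chartInvDeriv x₀ y)) '' (W : Set _))) :
    ∃ ϑ : Fin r → (Tangent m (chartInv x₀ y) →L[ℝ] ℂ),
      Submodule.span ℂ (Set.range ϑ) = W ∧ θ = fun k => (ϑ k).comp (chartInvDeriv x₀ y) := by
  obtain ⟨D, hD⟩ := chartInvDeriv_isInvertible hy
  refine ⟨fun k => (θ k).comp (D.symm : Tangent m (chartInv x₀ y) →L[ℝ] _), ?_, ?_⟩
  · rw [← hD] at hθ
    exact span_comp_symm_eq D hθ
  · funext k
    ext w
    simp [← hD]

/-- Transversality of a form at `φ⁻¹(y)`, tested in the chart `φ` by means of a frame of the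
conormal bundle in the chart. -/
theorem isTransverseForm_chartInv_of_positivityRatio [IsManifold (𝓡 m) ∞ M] {hp : p ≤ r}
    {F : TransverselyHolomorphicFoliation m r M} {α : Form m M (p + p)}
    (hα : F.IsBasic α) (hreal : α.IsReal) {x₀ : M} {y : EuclideanSpace ℝ (Fin m)}
    (hy : y ∈ chartTarget (m := m) x₀) {θ : Fin r → (EuclideanSpace ℝ (Fin m) →L[ℝ] ℂ)}
    (hθ : Submodule.span ℂ (Set.range θ) =
      Submodule.span ℂ ((fun η : Tangent m (chartInv x₀ y) →L[ℝ] ℂ =>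
        η.comp (chartInvDeriv x₀ y)) '' (F.conormal10 (chartInv x₀ y) : Set _)))
    {v : Fin (p + p + (r - p) * 2) → EuclideanSpace ℝ (Fin m)}
    (hv : (elementaryForm θ).domDomCongr
      (finCongr (by omega : r * 2 = p + p + (r - p) * 2)) v ≠ 0)
    (hpos : ∀ c ∈ orthonormalRows (r - p) r,
      0 < (positivityRatio hp (α.inChart x₀ y).toAlternatingMap θ c v).re) :
    IsTransverseForm (F.conormal10 (chartInv x₀ y)) r p hp
      (α (chartInv x₀ y)).toAlternatingMap := by
  obtain ⟨ϑ, hϑ, hθϑ⟩ := exists_frame_of_chart hy hθ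
  rw [← hϑ]
  refine isTransverseForm_of_positivityRatio hp (v := fun i => chartInvDeriv x₀ y (v i))
    (F.frameMap_surjective_of_span_eq hϑ) (fun w => hreal _ w)
    (fun w ⟨i, hi⟩ => hα.contract _ w ⟨i, F.mem_leafTangent_of_frame hϑ hi⟩) ?_ fun c hc => ?_
  · rw [hθϑ, elementaryForm_compLinearMap] at hv
    exact hv
  · have := hpos c hc
    rw [hθϑ] at this
    exact lt_of_lt_of_eq this (congrArg Complex.re (positivityRatio_comp hp
      (α (chartInv x₀ y)).toAlternatingMap ϑ c (chartInvDeriv x₀ y) v))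

/-- A form transverse at `φ⁻¹(y)` has positive ratio on every orthonormal tuple, computed in the
chart `φ` on vectors `v` chosen so that the volume form of the frame does not vanish on them. -/
theorem IsTransverseForm.positivityRatio_inChart_pos [IsManifold (𝓡 m) ∞ M] {hp : p ≤ r}
    {F : TransverselyHolomorphicFoliation m r M} {α : Form m M (p + p)} {x₀ : M}
    {y : EuclideanSpace ℝ (Fin m)}
    (hy : y ∈ chartTarget (m := m) x₀) {θ : Fin r → (EuclideanSpace ℝ (Fin m) →L[ℝ] ℂ)}
    (hθ : Submodule.span ℂ (Set.range θ) =
      Submodule.span ℂ ((fun η : Tangent m (chartInv x₀ y) →L[ℝ] ℂ =>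
        η.comp (chartInvDeriv x₀ y)) '' (F.conormal10 (chartInv x₀ y) : Set _)))
    (h : IsTransverseForm (F.conormal10 (chartInv x₀ y)) r p hp
      (α (chartInv x₀ y)).toAlternatingMap) :
    ∃ v : Fin (p + p + (r - p) * 2) → EuclideanSpace ℝ (Fin m),
      (elementaryForm θ).domDomCongr
        (finCongr (by omega : r * 2 = p + p + (r - p) * 2)) v ≠ 0 ∧
      ∀ c ∈ orthonormalRows (r - p) r,
        0 < (positivityRatio hp (α.inChart x₀ y).toAlternatingMap θ c v).re := by
  obtain ⟨ϑ, hϑ, hθϑ⟩ := exists_frame_of_chart hy hθ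
  have hsurj := F.frameMap_surjective_of_span_eq hϑ
  obtain ⟨w, hw⟩ := exists_elementaryForm_ne_zero hsurj
  obtain ⟨D, hD⟩ := chartInvDeriv_isInvertible hy
  have hDv : ∀ z, chartInvDeriv x₀ y (D.symm z) = z := fun z => by rw [← hD]; simp
  let e := finCongr (by omega : r * 2 = p + p + (r - p) * 2)
  have hv : (elementaryForm ϑ).domDomCongr e
      (fun i => chartInvDeriv x₀ y (D.symm (w (e.symm i)))) ≠ 0 := by
    have hwe : (fun i => w (e.symm i)) ∘ e = w := by
      funext i
      simp
    simp only [hDv]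
    rw [AlternatingMap.domDomCongr_apply, hwe]
    exact hw
  refine ⟨fun i => D.symm (w (e.symm i)), ?_, fun c hc => ?_⟩
  · rw [hθϑ, elementaryForm_compLinearMap]
    exact hv
  · rw [← hϑ] at h
    have := h.positivityRatio_pos (linearIndependent_of_frameMap_surjective hsurj) hv hc
    rw [hθϑ]
    exact lt_of_lt_of_eq this (congrArg Complex.re (positivityRatio_comp hp
      (α (chartInv x₀ y)).toAlternatingMap ϑ c (chartInvDeriv x₀ y) _).symm)

/-- Openness of transversality in the parameter and the point jointly, near `(t₀, x₀)`. -/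
theorem eventually_isTransverseForm [IsManifold (𝓡 m) ∞ M] {P : Type*} [NormedAddCommGroup P]
    [NormedSpace ℝ P] {hp : p ≤ r} {U : Set P} (hU : IsOpen U)
    {F : P → TransverselyHermitianFoliation m r M} (hF : IsSmoothFamily U F)
    {Ω : P → Form m M (p + p)} (hΩ_smooth : Form.SmoothFamilyOn U Ω)
    (hΩ_real : ∀ t ∈ U, (Ω t).IsReal) (hΩ_type : ∀ t ∈ U, (F t).IsBasicOfType p p (Ω t))
    {t₀ : P} (ht₀ : t₀ ∈ U) (hpos : (F t₀).IsTransversePositive p hp (Ω t₀)) (x₀ : M) :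
    ∀ᶠ q : P × M in 𝓝 (t₀, x₀),
      IsTransverseForm ((F q.1).conormal10 q.2) r p hp (Ω q.1 q.2).toAlternatingMap := by
  obtain ⟨y₀, hy₀def⟩ : ∃ y, y = extChartAt (𝓡 m) x₀ x₀ := ⟨_, rfl⟩
  have hy₀ : y₀ ∈ chartTarget (m := m) x₀ := hy₀def ▸ mem_extChartAt_target x₀
  have hinv : ∀ x ∈ (extChartAt (𝓡 m) x₀).source, chartInv x₀ (extChartAt (𝓡 m) x₀ x) = x :=
    fun x hx => (extChartAt (𝓡 m) x₀).left_inv hx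
  have hopen : IsOpen (chartTarget (m := m) x₀) := isOpen_extChartAt_target x₀
  obtain ⟨W, θ, hWo, hqW, hWU, hθ, hspan⟩ := hF.conormal x₀ t₀ ht₀ y₀ hy₀
  have hpos₀ := hpos (chartInv x₀ y₀)
  have hspan₀ := hspan (t₀, y₀) hqW
  obtain ⟨v, hv, hvpos⟩ := IsTransverseForm.positivityRatio_inChart_pos (hp := hp)
    (F := (F t₀).toTransverselyHolomorphicFoliation) (α := Ω t₀)
    (θ := fun k => θ k (t₀, y₀)) hy₀ hspan₀ hpos₀
  have hθc : ∀ k, ContinuousAt (θ k) (t₀, y₀) := fun k =>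
    (hθ k).continuousOn.continuousAt (hWo.mem_nhds hqW)
  have hΩc : ContinuousAt (fun q : P × EuclideanSpace ℝ (Fin m) => (Ω q.1).inChart x₀ q.2)
      (t₀, y₀) :=
    (hΩ_smooth x₀).continuousOn.continuousAt ((hU.prod hopen).mem_nhds ⟨ht₀, hy₀⟩)
  have hE : ∀ᶠ q in 𝓝 (t₀, y₀), (elementaryForm fun k => θ k q).domDomCongr
      (finCongr (by omega : r * 2 = p + p + (r - p) * 2)) v ≠ 0 :=
    (continuousAt_elementaryForm hθc _).eventually_ne hv
  have hratio : ∀ᶠ q in 𝓝 (t₀, y₀), ∀ c ∈ orthonormalRows (r - p) r,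
      0 < (positivityRatio hp ((Ω q.1).inChart x₀ q.2).toAlternatingMap
        (fun k => θ k q) c v).re := by
    -- Tube lemma over the compact set of orthonormal tuples.
    refine (isCompact_orthonormalRows (r - p) r).eventually_forall_of_forall_eventually
      fun c hc => ?_
    have hcont : ContinuousAt (fun z : (P × EuclideanSpace ℝ (Fin m)) ×
        Matrix (Fin (r - p)) (Fin r) ℂ => positivityRatio hp
          ((Ω z.1.1).inChart x₀ z.1.2).toAlternatingMap (fun k => θ k z.1) z.2 v)
        ((t₀, y₀), c) :=
      continuousAt_positivityRatio hp (hΩc.comp_of_eq continuousAt_fst rfl)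
        (fun k => (hθc k).comp_of_eq continuousAt_fst rfl) continuousAt_snd hv
    exact (Complex.continuous_re.continuousAt.comp hcont).eventually_const_lt (hvpos c hc)
  have hchart : ∀ᶠ q in 𝓝 (t₀, y₀), IsTransverseForm ((F q.1).conormal10 (chartInv x₀ q.2)) r p
      hp (Ω q.1 (chartInv x₀ q.2)).toAlternatingMap := by
    filter_upwards [hE, hratio, hWo.mem_nhds hqW] with q hq1 hq2 hq3
    obtain ⟨ht, hy⟩ := hWU hq3
    exact isTransverseForm_chartInv_of_positivityRatio (hΩ_type _ ht).basic (hΩ_real _ ht) hy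
      (hspan q hq3) hq1 hq2
  have htend : Filter.Tendsto (fun q : P × M => (q.1, extChartAt (𝓡 m) x₀ q.2)) (𝓝 (t₀, x₀))
      (𝓝 (t₀, y₀)) := by
    rw [hy₀def]
    exact continuousAt_fst.tendsto.prodMk_nhds
      ((continuousAt_extChartAt x₀).tendsto.comp continuousAt_snd)
  have hsrc : ∀ᶠ q : P × M in 𝓝 (t₀, x₀), q.2 ∈ (extChartAt (𝓡 m) x₀).source :=
    continuousAt_snd.eventually (extChartAt_source_mem_nhds x₀)
  filter_upwards [htend.eventually hchart, hsrc] with q hq hq2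
  have hx := hinv q.2 hq2
  simp only at hq
  rwa [hx] at hq

end Openness

end TransverseFoliation

end

theorem mainTheorem10 {m r d p : ℕ} (hp₁ : 1 ≤ p) (hp : p ≤ r)
    {M : Type*} [TopologicalSpace M] [ChartedSpace (EuclideanSpace ℝ (Fin m)) M]
    [IsManifold (𝓡 m) ∞ M] [CompactSpace M] [T2Space M]
    {U : Set (EuclideanSpace ℝ (Fin d))} (hU : IsOpen U) (hU₀ : 0 ∈ U)
    (F : EuclideanSpace ℝ (Fin d) → TransverseFoliation.TransverselyHermitianFoliation m r M)
    (hF : TransverseFoliation.IsSmoothFamily U F)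
    (hF_fixed : TransverseFoliation.HasFixedDifferentiableType U F)
    (Ω : EuclideanSpace ℝ (Fin d) → TransverseFoliation.Form m M (p + p))
    (hΩ_smooth : TransverseFoliation.Form.SmoothFamilyOn U Ω)
    (hΩ_real : ∀ t ∈ U, (Ω t).IsReal)
    (hΩ_type : ∀ t ∈ U, (F t).IsBasicOfType p p (Ω t))
    (hΩ_pos : (F 0).IsTransversePositive p hp (Ω 0)) :
    ∃ ε : ℝ, 0 < ε ∧ ∀ t ∈ U, ‖t‖ < ε → (F t).IsTransversePositive p hp (Ω t) := by
  have h : ∀ᶠ t in 𝓝 (0 : EuclideanSpace ℝ (Fin d)), ∀ x ∈ (Set.univ : Set M),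
      TransverseFoliation.IsTransverseForm ((F t).conormal10 x) r p hp
        (Ω t x).toAlternatingMap :=
    isCompact_univ.eventually_forall_of_forall_eventually fun x _ =>
      TransverseFoliation.eventually_isTransverseForm hU hF hΩ_smooth hΩ_real hΩ_type hU₀ hΩ_pos x
  obtain ⟨ε, hε, hball⟩ := Metric.eventually_nhds_iff.1 h
  exact ⟨ε, hε, fun t _ ht x => hball (by simpa using ht) x (Set.mem_univ x)⟩
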